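/- **Language.** Constructor types are $\gamma ::= \iota \mid \gamma\to\gamma$; predicate types are $\rho ::= o \mid \sigma\to\rho$, where argument types $\sigma$ are constructor types or predicate types. Fix a finite signature $\Sigma$ of function symbols $c:\gamma$ and a finite signature $\Pi$ of predicate symbols $P:\rho$. Terms are the well-typed terms $s,t ::= x \mid c \mid P \mid s\,t$ over a finite type context $\Delta$ of typed variables; atomic formulas $A$ are the terms of type $o$. Goal formulas are $G,H ::= A \mid G\wedge H \mid \exists x{:}\sigma.\,G \mid \mathsf{true}$. Definite formulas are (possibly empty) finite conjunctions of definite clauses of the forms $\forall \bar y{:}\bar\sigma.\; G\Rightarrow P\,\bar y$ and $\forall \bar y{:}\bar\sigma.\; G\Rightarrow P\,(c\,\bar y)$, with $\bar y$ distinct and everything well typed; formulas are taken up to renaming of bound variables. **Proof system.** For a definite formula $D$ and goal formulas over the same context $\Delta$ (empty in the case of closed formulas), $D\vdash G$ is the least relation such that: $D\vdash\mathsf{true}$; if $D\vdash G$ and $D\vdash H$ then $D\vdash G\wedge H$; if $D\vdash G[t/x]$ for some term $t:\sigma$ over $\Delta$, then $D\vdash\exists x{:}\sigma.\,G$; if $(\forall\bar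 y{:}\bar\sigma.\,G\Rightarrow A)$ is a clause of $D$, and $D\vdash G[\bar s/\bar y]$ for some terms $\bar s:\bar\sigma$ over $\Delta$, then $D\vdash A[\bar s/\bar y]$. **Statement.** Let $\rho$ be a predicate type, let $\mho_\rho:\rho$ be a predicate symbol in $\Pi$, and let $D$ be a definite formula over $\Delta$ that contains the universal clause $\forall\bar y.\,\mathsf{true}\Rightarrow\mho_\rho\,\bar y$ (so that $\mho_\rho$ is a universal relation of type $\rho$). Then for every goal formula $G$ over $\Delta, x{:}\rho$, $$D\vdash\exists x{:}\rho.\,G\quad\text{if and only if}\quad D\vdash G[\mho_\rho/x].$$ -/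

import Mathlib

namespace HOMSL

/-- Constructor types `γ ::= ι | γ → γ`: simple types over the type `ι` of individuals. -/
inductive ConTy : Type
  | iota : ConTy
  | arr : ConTy → ConTy → ConTy

mutual
/-- Predicate types `ρ ::= o | σ → ρ`. -/
inductive PredTy : Type
  | prop : PredTy
  | arr : Ty → PredTy → PredTy
/-- Predicate argument types `σ ::= γ | ρ`. These are also all the types of the language. -/
inductive Ty : Type
  | con : ConTy → Ty
  | pred : PredTy → Ty
end

/-- The type `γ₁ → ⋯ → γₙ → γ`. -/
def ConTy.arrows : List ConTy → ConTy → ConTy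
  | [], γ => γ
  | γ₁ :: γs, γ => .arr γ₁ (ConTy.arrows γs γ)

/-- The argument types `[σ₁, …, σₙ]` of a predicate type `σ₁ → ⋯ → σₙ → o`. -/
def PredTy.args : PredTy → List Ty
  | .prop => []
  | .arr σ ρ => σ :: PredTy.args ρ

/-- A pair of finite signatures: `Con γ` is the set of function symbols of type `γ`, and `Pred ρ`
is the set of predicate symbols of type `ρ`. -/
structure Signature where
  Con : ConTy → Type
  Pred : PredTy → Type
  finite_con : Finite (Σ γ, Con γ)
  finite_pred : Finite (Σ ρ, Pred ρ)

/-- Type contexts. Variables are de Bruijn indices, so that formulas are identified up to renaming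
of bound variables. -/
abbrev Ctx : Type := List Ty

/-- `Var Δ τ` is the type of the variables of type `τ` in the context `Δ`. -/
inductive Var : Ctx → Ty → Type
  | head {Δ : Ctx} {τ : Ty} : Var (τ :: Δ) τ
  | tail {Δ : Ctx} {τ τ' : Ty} : Var Δ τ → Var (τ' :: Δ) τ

/-- `Term S Δ τ` is the type of the well-typed terms `Δ ⊢ t : τ`. There is one application
constructor for each of the two kinds of function types, `γ₁ → γ₂` and `σ → ρ`. -/
inductive Term (S : Signature) (Δ : Ctx) : Ty → Type
  | var {τ : Ty} : Var Δ τ → Term S Δ τ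
  | con {γ : ConTy} : S.Con γ → Term S Δ (.con γ)
  | pred {ρ : PredTy} : S.Pred ρ → Term S Δ (.pred ρ)
  | capp {γ₁ γ₂ : ConTy} :
      Term S Δ (.con (.arr γ₁ γ₂)) → Term S Δ (.con γ₁) → Term S Δ (.con γ₂)
  | papp {σ : Ty} {ρ : PredTy} :
      Term S Δ (.pred (.arr σ ρ)) → Term S Δ σ → Term S Δ (.pred ρ)

/-- Well-typed goal formulas `G, H ::= A | G ∧ H | ∃ x:σ. G | true`, where the atomic formulas `A`
are the terms of type `o`. -/
inductive Goal (S : Signature) : Ctx → Type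
  | atom {Δ : Ctx} : Term S Δ (.pred .prop) → Goal S Δ
  | and {Δ : Ctx} : Goal S Δ → Goal S Δ → Goal S Δ
  | ex {Δ : Ctx} (σ : Ty) : Goal S (σ :: Δ) → Goal S Δ
  | top {Δ : Ctx} : Goal S Δ

/-- Type-preserving renamings of the variables in `Γ` by variables in `Δ`. -/
abbrev Ren (Γ Δ : Ctx) : Type := ∀ τ : Ty, Var Γ τ → Var Δ τ

/-- Well-typed simultaneous substitutions of terms over `Δ` for the variables in `Γ`. -/
abbrev Sub (S : Signature) (Γ Δ : Ctx) : Type := ∀ τ : Ty, Var Γ τ → Term S Δ τ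

def Term.rename {S : Signature} {Γ Δ : Ctx} (r : Ren Γ Δ) : {τ : Ty} → Term S Γ τ → Term S Δ τ
  | _, .var v => .var (r _ v)
  | _, .con c => .con c
  | _, .pred P => .pred P
  | _, .capp s t => .capp (s.rename r) (t.rename r)
  | _, .papp s t => .papp (s.rename r) (t.rename r)

def Term.subst {S : Signature} {Γ Δ : Ctx} (θ : Sub S Γ Δ) : {τ : Ty} → Term S Γ τ → Term S Δ τ
  | _, .var v => θ _ v
  | _, .con c => .con c
  | _, .pred P => .pred P
  | _, .capp s t => .capp (s.subst θ) (t.subst θ)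
  | _, .papp s t => .papp (s.subst θ) (t.subst θ)

/-- The substitution `θ` under a binder. -/
def Sub.lift {S : Signature} {Γ Δ : Ctx} (θ : Sub S Γ Δ) (σ : Ty) : Sub S (σ :: Γ) (σ :: Δ)
  | _, .head => .var .head
  | _, .tail v => (θ _ v).rename (fun _ w => .tail w)

/-- Capture-avoiding substitution in goal formulas. -/
def Goal.subst {S : Signature} : {Γ Δ : Ctx} → Sub S Γ Δ → Goal S Γ → Goal S Δ
  | _, _, θ, .atom A => .atom (A.subst θ)
  | _, _, θ, .and G H => .and (G.subst θ) (H.subst θ)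
  | _, _, θ, .ex σ G => .ex σ (G.subst (θ.lift σ))
  | _, _, _, .top => .top

/-- The substitution `[s₁/y₁, …, sₙ/yₙ]` for the variables `y₁, …, yₙ` declared in `Γ`, which leaves
the variables in `Δ` unchanged. -/
def Sub.extend {S : Signature} {Δ : Ctx} : {Γ : Ctx} → Sub S Γ Δ → Sub S (Γ ++ Δ) Δ
  | [], _, _, v => .var v
  | _ :: _, s, _, .head => s _ .head
  | _ :: _, s, _, .tail v => Sub.extend (fun _ w => s _ (.tail w)) _ v

/-- The substitution `[t/x]` for the variable `x` declared last, as a substitution for `[x : σ]`. -/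
def Sub.single {S : Signature} {Δ : Ctx} {σ : Ty} (t : Term S Δ σ) : Sub S [σ] Δ
  | _, .head => t

/-- `G[t/x]`, where `x : σ` is the variable declared last. -/
def Goal.inst {S : Signature} {Δ : Ctx} {σ : Ty} (G : Goal S (σ :: Δ)) (t : Term S Δ σ) :
    Goal S Δ :=
  G.subst (Sub.extend (Sub.single t))

/-- A variable of the context `Γ`, seen in the context `Γ ++ Δ`. -/
def Var.inl {Δ : Ctx} : {Γ : Ctx} → {τ : Ty} → Var Γ τ → Var (Γ ++ Δ) τ
  | _, _, .head => .head
  | _, _, .tail v => .tail v.inl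

/-- The atomic formula `t s₁ … sₙ` for `t : σ₁ → ⋯ → σₙ → o`. -/
def Term.papps {S : Signature} {Δ : Ctx} : {ρ : PredTy} → Term S Δ (.pred ρ) →
    Sub S ρ.args Δ → Term S Δ (.pred .prop)
  | .prop, t, _ => t
  | .arr _ _, t, s => Term.papps (.papp t (s _ .head)) (fun _ v => s _ (.tail v))

/-- The term `t s₁ … sₙ : γ` for `t : γ₁ → ⋯ → γₙ → γ`. -/
def Term.capps {S : Signature} {Δ : Ctx} {γ : ConTy} : {γs : List ConTy} →
    Term S Δ (.con (ConTy.arrows γs γ)) → Sub S (γs.map .con) Δ → Term S Δ (.con γ)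
  | [], t, _ => t
  | _ :: _, t, s => Term.capps (.capp t (s _ .head)) (fun _ v => s _ (.tail v))

/-- The two forms of definite clauses: `shallow P G` is `∀ y₁ … yₙ. G ⇒ P y₁ … yₙ`, and
`deep P c G` is `∀ y₁ … yₙ. G ⇒ P (c y₁ … yₙ)`. The context `Δ` declares the free variables of the
clause; it is empty for closed clauses. -/
inductive Clause (S : Signature) (Δ : Ctx) : Type
  | shallow {ρ : PredTy} (P : S.Pred ρ) (G : Goal S (ρ.args ++ Δ)) : Clause S Δ
  | deep {γs : List ConTy} {γ : ConTy} (P : S.Pred (.arr (.con γ) .prop))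
      (c : S.Con (ConTy.arrows γs γ)) (G : Goal S (γs.map .con ++ Δ)) : Clause S Δ

/-- The types of the universally quantified variables `y₁, …, yₙ` of a clause. -/
def Clause.vars {S : Signature} {Δ : Ctx} : Clause S Δ → Ctx
  | .shallow (ρ := ρ) _ _ => ρ.args
  | .deep (γs := γs) _ _ _ => γs.map .con

/-- The body `G` of a clause `∀ y₁ … yₙ. G ⇒ A`. -/
def Clause.body {S : Signature} {Δ : Ctx} : (C : Clause S Δ) → Goal S (C.vars ++ Δ)
  | .shallow _ G => G
  | .deep _ _ G => G

/-- The head `A` of a clause `∀ y₁ … yₙ. G ⇒ A`. -/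
def Clause.head {S : Signature} {Δ : Ctx} :
    (C : Clause S Δ) → Term S (C.vars ++ Δ) (.pred .prop)
  | .shallow P _ => Term.papps (.pred P) (fun _ v => .var v.inl)
  | .deep P c _ => .papp (.pred P) (Term.capps (.con c) (fun _ v => .var v.inl))

/-- Definite formulas: conjunctions of definite clauses. -/
inductive Definite (S : Signature) (Δ : Ctx) : Type
  | clause : Clause S Δ → Definite S Δ
  | and : Definite S Δ → Definite S Δ → Definite S Δ
  | top : Definite S Δ

/-- `D.Has C`: the clause `C` is one of the conjuncts of `D`. -/
def Definite.Has {S : Signature} {Δ : Ctx} : Definite S Δ → Clause S Δ → Prop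
  | .clause C', C => C = C'
  | .and D E, C => D.Has C ∨ E.Has C
  | .top, _ => False

/-- The proof system: `Provable D G` is the judgement `D ⊢ G`, for `D` and `G` over the same
context `Δ` of free variables (empty for closed formulas). -/
inductive Provable {S : Signature} {Δ : Ctx} (D : Definite S Δ) : Goal S Δ → Prop
  | top : Provable D .top
  | and {G H : Goal S Δ} : Provable D G → Provable D H → Provable D (.and G H)
  | ex {σ : Ty} {G : Goal S (σ :: Δ)} (t : Term S Δ σ) :
      Provable D (G.inst t) → Provable D (.ex σ G)
  | res {C : Clause S Δ} (hC : D.Has C) (s : Sub S C.vars Δ) :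
      Provable D (C.body.subst (Sub.extend s)) →
      Provable D (.atom (C.head.subst (Sub.extend s)))

/-- The universal clause `∀ y₁ … yₙ. true ⇒ U y₁ … yₙ`, which axiomatises the predicate symbol `U`
as a universal relation. -/
def Clause.universal {S : Signature} (Δ : Ctx) {ρ : PredTy} (U : S.Pred ρ) : Clause S Δ :=
  .shallow U .top

end HOMSL

/-!
The content of the theorem is that `D ⊢ G[t/x]` implies `D ⊢ G[U/x]` for every term `t : ρ`. In the
logic, predicates occur only positively, so replacing some predicate subterms of a provable goal by
larger ones should keep it provable, and the universal relation is the largest one.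

This is made precise by a syntactic preorder. A term is *universal* (`Term.IsUniv`) if it is a
partial application `U r₁ … rₖ`, and `t ≤ t'` (`Term.Le`) if `t'` arises from `t` by replacing some
subterms of predicate type by universal terms of the same type; `Goal.Le` extends this to goals.
Provability is monotone for this preorder (`Provable.mono`), by induction on derivations. The only
interesting case is resolution, with conclusion `P s₁ … sₙ ≤ A'`. Either `A'` is universal, and
then it follows from the universal clause, or `A' = P s₁' … sₙ'` with `sᵢ ≤ sᵢ'`
(`Term.Le.papps_inv`), and then the same clause applies with `s'` instead of `s`, because
substitution is monotone (`Goal.Le.subst`). If the head of the clause is `P (c s₁ … sₙ)`, the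
argument of `P` is unchanged in the second case: terms of constructor type have no subterms of
predicate type (`Term.Le.eq_of_con`).
-/

namespace HOMSL

/-! ### Substitution in iterated applications -/

/-- The substitution that sends the variable declared last to `t` and the others as `s` does. -/
def Sub.cons {S : Signature} {Γ Δ : Ctx} {σ : Ty} (t : Term S Δ σ) (s : Sub S Γ Δ) :
    Sub S (σ :: Γ) Δ
  | _, .head => t
  | _, .tail v => s _ v

theorem Sub.extend_inl {S : Signature} {Δ : Ctx} : {Γ : Ctx} → (s : Sub S Γ Δ) → {τ : Ty} →
    (v : Var Γ τ) → Sub.extend s τ v.inl = s τ v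
  | _, _, _, .head => rfl
  | _, s, _, .tail v => Sub.extend_inl (fun _ w => s _ (.tail w)) v

theorem Term.subst_papps {S : Signature} {Γ Δ : Ctx} (θ : Sub S Γ Δ) : (ρ : PredTy) →
    (t : Term S Γ (.pred ρ)) → (s : Sub S ρ.args Γ) →
    (Term.papps t s).subst θ = Term.papps (t.subst θ) (fun _ v => (s _ v).subst θ)
  | .prop, _, _ => rfl
  | .arr _ ρ, t, s => Term.subst_papps θ ρ (.papp t (s _ .head)) (fun _ v => s _ (.tail v))

theorem Clause.head_shallow_subst {S : Signature} {Δ : Ctx} {ρ : PredTy} (P : S.Pred ρ)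
    (G : Goal S (ρ.args ++ Δ)) (s : Sub S ρ.args Δ) :
    (Clause.shallow P G).head.subst (Sub.extend s) = Term.papps (.pred P) s := by
  refine (Term.subst_papps (Sub.extend s) ρ (.pred P) (fun _ v => .var v.inl)).trans ?_
  congr 1
  funext τ v
  exact Sub.extend_inl s v

/-! ### Universal terms -/

/-- The terms of the form `U r₁ … rₖ`, with `k` at most the arity of `U`. -/
inductive Term.IsUniv {S : Signature} {ρ : PredTy} (U : S.Pred ρ) {Δ : Ctx} :
    {ρ' : PredTy} → Term S Δ (.pred ρ') → Prop
  | pred : IsUniv U (.pred U)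
  | papp {σ : Ty} {ρ' : PredTy} {t : Term S Δ (.pred (.arr σ ρ'))} (a : Term S Δ σ) :
      IsUniv U t → IsUniv U (.papp t a)

theorem Term.IsUniv.rename {S : Signature} {ρ : PredTy} {U : S.Pred ρ} {Γ Δ : Ctx} (r : Ren Γ Δ)
    {ρ' : PredTy} {t : Term S Γ (.pred ρ')} (h : IsUniv U t) : IsUniv U (t.rename r) := by
  induction h with
  | pred => exact .pred
  | papp a _ ih => exact .papp _ ih

theorem Term.IsUniv.subst {S : Signature} {ρ : PredTy} {U : S.Pred ρ} {Γ Δ : Ctx} (θ : Sub S Γ Δ)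
    {ρ' : PredTy} {t : Term S Γ (.pred ρ')} (h : IsUniv U t) : IsUniv U (t.subst θ) := by
  induction h with
  | pred => exact .pred
  | papp a _ ih => exact .papp _ ih

theorem Term.IsUniv.papps {S : Signature} {ρ : PredTy} {U : S.Pred ρ} {Δ : Ctx} : {ρ' : PredTy} →
    {t : Term S Δ (.pred ρ')} → IsUniv U t → (s : Sub S ρ'.args Δ) → IsUniv U (Term.papps t s)
  | .prop, _, h, _ => h
  | .arr _ _, _, h, s => (h.papp (s _ .head)).papps (fun _ v => s _ (.tail v))

/-- Quantifying over the missing arguments `s` lets the induction on `t = U r₁ … rₖ` collect the `rᵢ`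
one at a time, until the universal clause applies to `U r₁ … rₖ s`. -/
theorem Term.IsUniv.provable_papps {S : Signature} {ρ : PredTy} {U : S.Pred ρ} {Δ : Ctx}
    {D : Definite S Δ} (hU : D.Has (Clause.universal Δ U)) {ρ' : PredTy}
    {t : Term S Δ (.pred ρ')} (h : IsUniv U t) :
    ∀ s : Sub S ρ'.args Δ, Provable D (.atom (Term.papps t s)) := by
  induction h with
  | pred =>
    intro s
    rw [← Clause.head_shallow_subst U .top s]
    exact .res hU s .top
  | papp a _ ih => exact fun s => ih (Sub.cons a s)

theorem Term.IsUniv.provable {S : Signature} {ρ : PredTy} {U : S.Pred ρ} {Δ : Ctx}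
    {D : Definite S Δ} (hU : D.Has (Clause.universal Δ U)) {A : Term S Δ (.pred .prop)}
    (h : IsUniv U A) : Provable D (.atom A) :=
  h.provable_papps hU (fun _ v => nomatch v)

/-! ### The preorder on terms -/

/-- `Term.Le U t t'`: the term `t'` arises from `t` by replacing some subterms of predicate type by
universal terms. Terms of constructor type have no such subterms, so there is no congruence rule
for their application. -/
inductive Term.Le {S : Signature} {ρ : PredTy} (U : S.Pred ρ) {Δ : Ctx} :
    {τ : Ty} → Term S Δ τ → Term S Δ τ → Prop
  | refl {τ : Ty} (t : Term S Δ τ) : Le U t t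
  | univ {ρ' : PredTy} (t : Term S Δ (.pred ρ')) {t' : Term S Δ (.pred ρ')} :
      IsUniv U t' → Le U t t'
  | papp {σ : Ty} {ρ' : PredTy} {t t' : Term S Δ (.pred (.arr σ ρ'))} {a a' : Term S Δ σ} :
      Le U t t' → Le U a a' → Le U (.papp t a) (.papp t' a')

theorem Term.Le.eq_of_con {S : Signature} {ρ : PredTy} {U : S.Pred ρ} {Δ : Ctx} {γ : ConTy}
    {t t' : Term S Δ (.con γ)} (h : Le U t t') : t = t' := by
  cases h
  rfl

theorem Term.Le.rename {S : Signature} {ρ : PredTy} {U : S.Pred ρ} {Γ Δ : Ctx} (r : Ren Γ Δ)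
    {τ : Ty} {t t' : Term S Γ τ} (h : Le U t t') : Le U (t.rename r) (t'.rename r) := by
  induction h with
  | refl t => exact .refl _
  | univ t h => exact .univ _ (h.rename r)
  | papp _ _ ih₁ ih₂ => exact .papp ih₁ ih₂

/-- The pointwise preorder on substitutions. -/
def Sub.Le {S : Signature} {ρ : PredTy} (U : S.Pred ρ) {Γ Δ : Ctx} (θ θ' : Sub S Γ Δ) : Prop :=
  ∀ (τ : Ty) (v : Var Γ τ), Term.Le U (θ τ v) (θ' τ v)

theorem Sub.Le.refl {S : Signature} {ρ : PredTy} (U : S.Pred ρ) {Γ Δ : Ctx} (θ : Sub S Γ Δ) :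
    Sub.Le U θ θ :=
  fun _ _ => .refl _

theorem Sub.Le.lift {S : Signature} {ρ : PredTy} {U : S.Pred ρ} {Γ Δ : Ctx} {θ θ' : Sub S Γ Δ}
    (h : Sub.Le U θ θ') (σ : Ty) : Sub.Le U (θ.lift σ) (θ'.lift σ)
  | _, .head => .refl _
  | _, .tail v => (h _ v).rename _

theorem Sub.Le.extend {S : Signature} {ρ : PredTy} {U : S.Pred ρ} {Δ : Ctx} : {Γ : Ctx} →
    {s s' : Sub S Γ Δ} → Sub.Le U s s' → Sub.Le U (Sub.extend s) (Sub.extend s')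
  | [], _, _, _, _, _ => .refl _
  | _ :: _, _, _, h, _, .head => h _ .head
  | _ :: _, _, _, h, _, .tail v =>
      Sub.Le.extend (fun _ w => h _ (.tail w)) _ v

theorem Term.subst_le_subst {S : Signature} {ρ : PredTy} {U : S.Pred ρ} {Γ Δ : Ctx}
    {θ θ' : Sub S Γ Δ} (hθ : Sub.Le U θ θ') {τ : Ty} (t : Term S Γ τ) :
    Le U (t.subst θ) (t.subst θ') := by
  induction t with
  | var v => exact hθ _ v
  | con c => exact .refl _
  | pred P => exact .refl _
  | capp s t ih₁ ih₂ =>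
    simp only [Term.subst]
    rw [ih₁.eq_of_con, ih₂.eq_of_con]
    exact .refl _
  | papp s t ih₁ ih₂ => exact .papp ih₁ ih₂

theorem Term.Le.subst {S : Signature} {ρ : PredTy} {U : S.Pred ρ} {Γ Δ : Ctx}
    {θ θ' : Sub S Γ Δ} (hθ : Sub.Le U θ θ') {τ : Ty} {t t' : Term S Γ τ} (h : Le U t t') :
    Le U (t.subst θ) (t'.subst θ') := by
  induction h with
  | refl t => exact Term.subst_le_subst hθ t
  | univ t h => exact .univ _ (h.subst θ')
  | papp _ _ ih₁ ih₂ => exact .papp ih₁ ih₂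

/-- A term above `t a` is universal or an application of a term above `t` to a term above `a`. -/
theorem Term.Le.papp_inv {S : Signature} {ρ : PredTy} {U : S.Pred ρ} {Δ : Ctx} {σ : Ty}
    {ρ' : PredTy} {t : Term S Δ (.pred (.arr σ ρ'))} {a : Term S Δ σ} {b : Term S Δ (.pred ρ')}
    (h : Le U (.papp t a) b) :
    IsUniv U b ∨ ∃ t' a', b = .papp t' a' ∧ Le U t t' ∧ Le U a a' := by
  cases h with
  | refl => exact .inr ⟨_, _, rfl, .refl _, .refl _⟩
  | univ _ h => exact .inl h
  | papp h₁ h₂ => exact .inr ⟨_, _, rfl, h₁, h₂⟩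

theorem Term.Le.papps_inv {S : Signature} {ρ : PredTy} {U : S.Pred ρ} {Δ : Ctx} :
    {ρ' : PredTy} → {t : Term S Δ (.pred ρ')} → {s : Sub S ρ'.args Δ} →
    {A : Term S Δ (.pred .prop)} → Le U (Term.papps t s) A →
    IsUniv U A ∨ ∃ t' s', A = Term.papps t' s' ∧ Le U t t' ∧ Sub.Le U s s'
  | .prop, _, s, A, h => .inr ⟨A, s, rfl, h, .refl U s⟩
  | .arr _ ρ', t, s, A, h => by
    obtain hA | ⟨b, s', rfl, hb, hs⟩ :=
      Term.Le.papps_inv (ρ' := ρ') (t := .papp t (s _ .head)) (s := fun _ v => s _ (.tail v)) h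
    · exact .inl hA
    · obtain hb | ⟨t', a', rfl, ht, ha⟩ := hb.papp_inv
      · exact .inl (hb.papps s')
      · refine .inr ⟨t', Sub.cons a' s', rfl, ht, ?_⟩
        rintro _ (_ | v)
        · exact ha
        · exact hs _ v

theorem Term.Le.pred_inv {S : Signature} {ρ : PredTy} {U : S.Pred ρ} {Δ : Ctx} {ρ' : PredTy}
    {P : S.Pred ρ'} {t : Term S Δ (.pred ρ')} (h : Le U (.pred P) t) :
    IsUniv U t ∨ t = .pred P := by
  cases h with
  | refl => exact .inr rfl
  | univ _ h => exact .inl h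

/-! ### The preorder on goals and the monotonicity of provability -/

/-- The preorder on goal formulas induced by the preorder on terms. -/
inductive Goal.Le {S : Signature} {ρ : PredTy} (U : S.Pred ρ) :
    {Δ : Ctx} → Goal S Δ → Goal S Δ → Prop
  | atom {Δ : Ctx} {A A' : Term S Δ (.pred .prop)} : Term.Le U A A' → Le U (.atom A) (.atom A')
  | and {Δ : Ctx} {G G' H H' : Goal S Δ} : Le U G G' → Le U H H' → Le U (.and G H) (.and G' H')
  | ex {Δ : Ctx} (σ : Ty) {G G' : Goal S (σ :: Δ)} : Le U G G' → Le U (.ex σ G) (.ex σ G')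
  | top {Δ : Ctx} : Le U (.top : Goal S Δ) .top

theorem Goal.Le.refl {S : Signature} {ρ : PredTy} (U : S.Pred ρ) {Δ : Ctx} (G : Goal S Δ) :
    Le U G G := by
  induction G with
  | atom A => exact .atom (.refl A)
  | and _ _ ih₁ ih₂ => exact .and ih₁ ih₂
  | ex σ _ ih => exact .ex σ ih
  | top => exact .top

theorem Goal.Le.subst {S : Signature} {ρ : PredTy} {U : S.Pred ρ} {Γ : Ctx} {G G' : Goal S Γ}
    (h : Le U G G') : ∀ {Δ : Ctx} {θ θ' : Sub S Γ Δ}, Sub.Le U θ θ' →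
      Le U (G.subst θ) (G'.subst θ') := by
  induction h with
  | atom h => exact fun hθ => .atom (h.subst hθ)
  | and _ _ ih₁ ih₂ => exact fun hθ => .and (ih₁ hθ) (ih₂ hθ)
  | ex σ _ ih => exact fun hθ => .ex σ (ih (hθ.lift σ))
  | top => exact fun _ => .top

theorem Provable.mono {S : Signature} {ρ : PredTy} {U : S.Pred ρ} {Δ : Ctx} {D : Definite S Δ}
    (hU : D.Has (Clause.universal Δ U)) {G : Goal S Δ} (h : Provable D G) :
    ∀ {G' : Goal S Δ}, Goal.Le U G G' → Provable D G' := by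
  induction h with
  | top =>
    rintro _ ⟨⟩
    exact .top
  | and _ _ ih₁ ih₂ =>
    intro _ hG
    cases hG with
    | and h₁ h₂ => exact .and (ih₁ h₁) (ih₂ h₂)
  | ex t _ ih =>
    intro _ hG
    cases hG with
    | ex _ hG => exact .ex t (ih (hG.subst (.refl U _)))
  | @res C hC s hb ih =>
    intro G' hG
    cases hG with
    | @atom _ _ A' hA =>
    cases C with
    | shallow P G =>
      replace hA : Term.Le U (Term.papps (.pred P) s) A' :=
        (congrArg (Term.Le U · A') (Clause.head_shallow_subst P G s)).mp hA
      obtain hA | ⟨t', s', rfl, ht, hs⟩ := hA.papps_inv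
      · exact hA.provable hU
      obtain ht | rfl := ht.pred_inv
      · exact (ht.papps s').provable hU
      rw [← Clause.head_shallow_subst P G s']
      exact .res hC s' (ih ((Goal.Le.refl U G).subst hs.extend))
    | deep P c G =>
      obtain hA | ⟨t', a', rfl, ht, ha⟩ := Term.Le.papp_inv hA
      · exact hA.provable hU
      obtain ht | rfl := ht.pred_inv
      · exact (ht.papp a').provable hU
      rw [← ha.eq_of_con]
      exact .res hC s hb

theorem Sub.Le.single {S : Signature} {ρ : PredTy} {U : S.Pred ρ} {Δ : Ctx} {σ : Ty}
    {t t' : Term S Δ σ} (h : Term.Le U t t') : Sub.Le U (Sub.single t) (Sub.single t')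
  | _, .head => h

end HOMSL

theorem mainTheorem8 (S : HOMSL.Signature) (Δ : HOMSL.Ctx) (D : HOMSL.Definite S Δ)
    (ρ : HOMSL.PredTy) (G : HOMSL.Goal S (HOMSL.Ty.pred ρ :: Δ))
    (U : S.Pred ρ) (hU : D.Has (HOMSL.Clause.universal Δ U)) :
    HOMSL.Provable D (HOMSL.Goal.ex (HOMSL.Ty.pred ρ) G) ↔
      HOMSL.Provable D (G.inst (HOMSL.Term.pred U)) := by
  refine ⟨fun h => ?_, fun h => .ex _ h⟩
  cases h with
  | ex t h =>
    have hle : HOMSL.Term.Le U t (.pred U) := .univ t .pred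
    exact h.mono hU ((HOMSL.Goal.Le.refl U G).subst (HOMSL.Sub.Le.single hle).extend)
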